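/- Fix integers $m\ge 1$ and $p_0\geq 4$. For distinct points $x_1,\dots,x_p\in\mathbb R^m$ let $A=(a_{ij})$ be the $p\times p$ matrix with $a_{ii}=0$ and $a_{ij}=1/|x_i-x_j|$ for $i\ne j$, and let $\partial A/\partial x_k$ be the matrix of vectors in $\mathbb R^m$ whose $(i,j)$ entry is the gradient of $a_{ij}$ with respect to $x_k$. We say that the Bahri–Xu inequality holds for $p$ (points in $\mathbb R^m$) if there is a constant $c=c(p,m)>0$ such that, for all distinct $x_1,\dots,x_p\in\mathbb R^m$ and all $U=(u_1,\dots,u_p)^{T}\in\mathbb R^p$, $$|AU|^2+\sup_{1\le i\le p}\left|U^{T}\left(\frac{\partial A}{\partial x_i}\right)U\right|\;\ge\; c\sum_{\substack{1\le i,j\le p\\ j\ne i}}\frac{u_j^2}{|x_i-x_j|^2},$$ where $|\cdot|$ denotes the Euclidean norm. Then the Bahri–Xu inequality holds for every $p$ with $4\le p\le p_0$ if and only if, for every $p$ with $4\le p\le p_0$ and all distinct $x_1,\dots,x_p\in\mathbb R^m$, the system $$\sum_{j\ne i}\frac{u_j}{|x_i-x_j|}=0,\qquad u_i\sum_{j\neq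 i}\frac{x_i-x_j}{|x_i-x_j|^3}\,u_j=0,\qquad 1\le i\le p,$$ has no non-zero real solution $(u_1,\dots,u_p)$. -/

import Mathlib

namespace BahriXu

noncomputable section

/-- The symmetric matrix `A` attached to points `x₁, …, x_p` of `ℝ^m`: zero on the diagonal,
and `1 / |x_i - x_j|` off the diagonal. -/
def A {p m : ℕ} (x : Fin p → EuclideanSpace ℝ (Fin m)) : Matrix (Fin p) (Fin p) ℝ :=
  Matrix.of fun i j => if i = j then 0 else 1 / ‖x i - x j‖

/-- The vector-valued matrix `∂A/∂x_k`: its `(i, j)` entry is the gradient of `a_{ij}` with respect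
to the `k`-th point, the other points being held fixed. -/
def dA {p m : ℕ} (x : Fin p → EuclideanSpace ℝ (Fin m)) (k : Fin p) :
    Matrix (Fin p) (Fin p) (EuclideanSpace ℝ (Fin m)) :=
  Matrix.of fun i j => gradient (fun y => A (Function.update x k y) i j) (x k)

/-- `Uᵀ M U` for a real vector `U` and a matrix `M` with entries in `ℝ^m`. -/
def quadForm {p m : ℕ} (M : Matrix (Fin p) (Fin p) (EuclideanSpace ℝ (Fin m)))
    (U : Fin p → ℝ) : EuclideanSpace ℝ (Fin m) :=
  ∑ i, ∑ j, (U i * U j) • M i j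

/-- The Bahri–Xu inequality for `p` points in `ℝ^m`: a single constant `c > 0` works for all
configurations of `p` distinct points and all `U ∈ ℝ^p`. The norm of `AU` is Euclidean. -/
def Inequality (p m : ℕ) : Prop :=
  ∃ c : ℝ, 0 < c ∧
    ∀ x : Fin p → EuclideanSpace ℝ (Fin m), Function.Injective x →
      ∀ U : Fin p → ℝ,
        c * ∑ i, ∑ j with j ≠ i, U j ^ 2 / ‖x i - x j‖ ^ 2 ≤
          ‖WithLp.toLp 2 ((A x).mulVec U)‖ ^ 2 + ⨆ i, ‖quadForm (dA x i) U‖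

/-- `u` solves the system attached to the points `x₁, …, x_p`. -/
def IsSolution {p m : ℕ} (x : Fin p → EuclideanSpace ℝ (Fin m)) (u : Fin p → ℝ) : Prop :=
  (∀ i, ∑ j with j ≠ i, u j / ‖x i - x j‖ = 0) ∧
    ∀ i, u i • ∑ j with j ≠ i, (u j / ‖x i - x j‖ ^ 3) • (x i - x j) = 0

end

end BahriXu

/-!
Read `u j` as a charge at `x j`. Up to a factor, the left-hand side of the inequality measures the
potentials `potential x u i` and the forces `u i • field x u i`, and the system says that all of
them vanish. So the inequality excludes solutions (`eq_zero_of_inequality`), and the content is the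
converse.

If the inequality fails for `p` points, homogeneity gives configurations whose right-hand side is
`1` and whose potentials and forces tend to zero (`exists_of_not_inequality`). Then all the ratios
`u j / |x i - x j|` are at most `1` in size, and along an ultrafilter all of them converge. A charge
with all these limits zero contributes nothing to the limiting equations. Among the others, rescale
so that the smallest charge is `1` and sits at the origin. All the relevant charges are then
separated by distances at least `1`, and those staying at bounded distance from the origin converge
to charges at distinct points `y` on which no force acts and on which the potential is a constant
`-b`. The constant comes from the relevant charges going to infinity, and there is such a charge if
`b ≠ 0`. This is `exists_limit_equilibrium`.

If `b = 0`, this limit is a solution for at most `p` points. If `b ≠ 0`, it is a solution with an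
additional charge `b` at infinity. The system is invariant under conformal maps, since
`1 / |x - y|` changes under an inversion only by factors depending on `x` and on `y`, and so an
inversion moves the additional charge to a finite point (`exists_solution_option_of_ne_zero`). The
equations at that point come for free: the potential vanishes by the virial identity
(`two_mul_sum_inner_field`), the force by the law of action and reaction (`sum_smul_field`). The
number of points is again at most `p`. Two or three points admit no solution at all
(`eq_zero_of_potential_eq_zero`), so in either case there is a solution for between `4` and `p`
points.
-/

namespace BahriXu

open Finset Filter Topology

/-! ### The system and Kelvin's transformation -/

section System

variable {ι κ E : Type*} [Fintype ι] [Fintype κ] [NormedAddCommGroup E] [InnerProductSpace ℝ E]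

/-- The potential at `x i` of charges `u j` placed at the points `x j`. The term `j = i` is
`u i / 0 = 0`, so it needs no exclusion from the sum. -/
noncomputable def potential (x : ι → E) (u : ι → ℝ) (i : ι) : ℝ := ∑ j, u j / ‖x i - x j‖

/-- The field at `x i` of charges `u j` placed at the points `x j`. The term `j = i` vanishes, so it
needs no exclusion from the sum. -/
noncomputable def field (x : ι → E) (u : ι → ℝ) (i : ι) : E :=
  ∑ j, (u j / ‖x i - x j‖ ^ 3) • (x i - x j)

/-- This includes `w = 0`, where both sides are `0` because of the division by zero. -/
theorem norm_div_norm_pow_three_smul (a : ℝ) (w : E) :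
    ‖(a / ‖w‖ ^ 3) • w‖ = |a| / ‖w‖ ^ 2 := by
  rcases eq_or_ne w 0 with rfl | hw
  · simp
  · have : ‖w‖ ≠ 0 := norm_ne_zero_iff.2 hw
    rw [norm_smul, Real.norm_eq_abs, abs_div, abs_of_nonneg (by positivity : 0 ≤ ‖w‖ ^ 3)]
    field_simp

/-- The internal forces add up to zero. -/
theorem sum_smul_field (x : ι → E) (u : ι → ℝ) : ∑ i, u i • field x u i = 0 := by
  have h : ∑ i, u i • field x u i = -∑ i, u i • field x u i := by
    simp only [field, smul_sum, ← sum_neg_distrib]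
    rw [sum_comm]
    refine sum_congr rfl fun i _ => sum_congr rfl fun j _ => ?_
    rw [norm_sub_rev, ← smul_neg, ← smul_neg, neg_sub, smul_smul, smul_smul]
    congr 1
    ring
  rw [eq_neg_iff_add_eq_zero, ← two_smul ℝ] at h
  exact (smul_eq_zero.1 h).resolve_left two_ne_zero

/-- The virial identity: Euler's relation for the energy, homogeneous of degree `-1`. -/
theorem two_mul_sum_inner_field (x : ι → E) (u : ι → ℝ) :
    2 * ∑ i, u i * inner ℝ (x i) (field x u i) = ∑ i, u i * potential x u i := by
  have h1 : ∑ i, u i * inner ℝ (x i) (field x u i)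
      = ∑ i, ∑ j, u i * u j / ‖x i - x j‖ ^ 3 * inner ℝ (x i) (x i - x j) := by
    simp only [field, inner_sum, mul_sum, inner_smul_right]
    exact sum_congr rfl fun i _ => sum_congr rfl fun j _ => by ring
  have h2 : ∑ i, u i * inner ℝ (x i) (field x u i)
      = ∑ i, ∑ j, u i * u j / ‖x i - x j‖ ^ 3 * -inner ℝ (x j) (x i - x j) := by
    rw [h1, sum_comm]
    refine sum_congr rfl fun i _ => sum_congr rfl fun j _ => ?_
    rw [norm_sub_rev, ← inner_neg_right, neg_sub, mul_comm (u j)]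
  rw [two_mul]
  nth_rewrite 1 [h1]
  rw [h2, ← sum_add_distrib]
  refine sum_congr rfl fun i _ => ?_
  rw [← sum_add_distrib, potential, mul_sum]
  refine sum_congr rfl fun j _ => ?_
  have h3 : inner ℝ (x i) (x i - x j) + -inner ℝ (x j) (x i - x j) = ‖x i - x j‖ ^ 2 := by
    rw [← sub_eq_add_neg, ← inner_sub_left, real_inner_self_eq_norm_sq]
  rw [← mul_add, h3]
  rcases eq_or_ne ‖x i - x j‖ 0 with h | h
  · simp [h]
  · field_simp

/-- Kelvin's transformation. Charges in equilibrium on which a constant potential `-b ≠ 0` is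
induced are seen, after an inversion, as a solution of the system with one more point: the charge
`b` sits at the image of infinity. -/
theorem exists_solution_option_of_ne_zero {x : ι → E} (hx : Function.Injective x) {u : ι → ℝ}
    {b : ℝ} (hb : b ≠ 0) (hpot : ∀ i, potential x u i + b = 0) (hfield : ∀ i, field x u i = 0)
    (h0 : ∀ i, x i ≠ 0) :
    ∃ z : Option ι → E, Function.Injective z ∧ ∃ v : Option ι → ℝ, v ≠ 0 ∧
      (∀ i, potential z v i = 0) ∧ ∀ i, v i • field z v i = 0 := by
  have hn : ∀ i, ‖x i‖ ≠ 0 := fun i => norm_ne_zero_iff.2 (h0 i)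
  -- By the virial identity `b * ∑ u = 0`; this is the equation at the new point.
  have hsum : ∑ i, u i = 0 := by
    have h := two_mul_sum_inner_field x u
    have hp : ∀ i, potential x u i = -b := fun i => eq_neg_of_add_eq_zero_left (hpot i)
    simp only [hfield, hp, inner_zero_right, mul_zero, sum_const_zero, ← sum_mul] at h
    exact (mul_eq_zero.1 h.symm).resolve_right (neg_ne_zero.2 hb)
  set y : ι → E := fun i => (1 / ‖x i‖) ^ 2 • x i with hy
  have hdist : ∀ i j, ‖y i - y j‖ = ‖x i - x j‖ / (‖x i‖ * ‖x j‖) := fun i j => by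
    have := dist_div_norm_sq_smul (h0 i) (h0 j) 1
    rw [dist_eq_norm, dist_eq_norm] at this
    rw [hy, this]
    ring
  have hnorm : ∀ i, ‖y i‖ = 1 / ‖x i‖ := fun i => by
    have := hn i
    rw [hy, norm_smul, norm_pow, norm_div, norm_norm, norm_one]
    field_simp
  set z : Option ι → E := fun o => o.elim 0 y with hz
  set v : Option ι → ℝ := fun o => o.elim b fun i => u i / ‖x i‖ with hv
  have hsome : ∀ i, field z v (some i) = 0 := fun i => by
    have hi := hn i
    -- The transformed force is the old force plus a multiple of `x i` that involves only the old
    -- potential and force.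
    have hterm : ∀ j, (u j / ‖x j‖ / ‖y i - y j‖ ^ 3) • (y i - y j)
        = ‖x i‖ ^ 3 • (u j / ‖x i - x j‖ ^ 3) • (x i - x j)
          + (‖x i‖ * (u j / ‖x i - x j‖
            - 2 * inner ℝ (x i) ((u j / ‖x i - x j‖ ^ 3) • (x i - x j)))) • x i := fun j => by
      rcases eq_or_ne j i with rfl | hji
      · simp
      have hj := hn j
      have hd : ‖x i - x j‖ ≠ 0 := norm_ne_zero_iff.2 (sub_ne_zero.2 (hx.ne hji.symm))
      have hsq : ‖x j‖ ^ 2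
          = ‖x i‖ ^ 2 - 2 * inner ℝ (x i) (x i - x j) + ‖x i - x j‖ ^ 2 := by
        rw [← norm_sub_sq_real, sub_sub_cancel]
      have hc : (‖x i‖ ^ 3 * (u j / ‖x i - x j‖ ^ 3)) + (‖x i‖ * (u j / ‖x i - x j‖
            - 2 * (u j / ‖x i - x j‖ ^ 3 * inner ℝ (x i) (x i - x j))))
          = ‖x i‖ * ‖x j‖ ^ 2 * (u j / ‖x i - x j‖ ^ 3) := by
        rw [hsq]
        field_simp
        ring
      rw [hdist, inner_smul_right, hy]
      have e1 : ‖x i‖ ^ 3 • (u j / ‖x i - x j‖ ^ 3) • (x i - x j)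
          = (‖x i‖ ^ 3 * (u j / ‖x i - x j‖ ^ 3)) • x i
            - (‖x i‖ ^ 3 * (u j / ‖x i - x j‖ ^ 3)) • x j := by
        rw [smul_smul, smul_sub]
      rw [e1, sub_add_eq_add_sub, ← add_smul, hc, smul_sub, smul_smul, smul_smul]
      congr 2 <;> field_simp
    have : field z v (some i) = (b / ‖y i‖ ^ 3) • y i
        + ∑ j, (u j / ‖x j‖ / ‖y i - y j‖ ^ 3) • (y i - y j) := by
      simp [field, Fintype.sum_option, hz, hv]
    rw [this, sum_congr rfl fun j _ => hterm j, sum_add_distrib, ← smul_sum, ← sum_smul,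
      ← mul_sum, sum_sub_distrib, ← mul_sum, ← inner_sum]
    change _ + (‖x i‖ ^ 3 • field x u i
      + (‖x i‖ * (potential x u i - 2 * inner ℝ (x i) (field x u i))) • x i) = 0
    rw [hfield, eq_neg_of_add_eq_zero_left (hpot i), hnorm, hy]
    simp only [smul_zero, zero_add, inner_zero_right, mul_zero, sub_zero, smul_smul, ← add_smul]
    convert zero_smul ℝ (x i) using 2
    field_simp
    ring
  refine ⟨z, ?_, v, fun h => hb (congrFun h none), ?_, ?_⟩
  · have hyne : ∀ i, y i ≠ 0 := fun i => by
      rw [← norm_ne_zero_iff, hnorm]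
      exact one_div_ne_zero (hn i)
    rintro (_ | i) (_ | j) h
    · rfl
    · exact absurd h.symm (hyne j)
    · exact absurd h (hyne i)
    · have h' : ‖y i - y j‖ = 0 := by
        rw [norm_eq_zero, sub_eq_zero]
        exact h
      rw [hdist, div_eq_zero_iff, norm_eq_zero, sub_eq_zero] at h'
      rw [hx (h'.resolve_right (mul_ne_zero (hn i) (hn j)))]
  · rintro (_ | i)
    · have : potential z v none = ∑ i, u i / ‖x i‖ / ‖y i‖ := by
        simp [potential, Fintype.sum_option, hz, hv]
      rw [this, ← hsum]
      refine sum_congr rfl fun i _ => ?_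
      have := hn i
      rw [hnorm]
      field_simp
    · have : potential z v (some i) = b / ‖y i‖ + ∑ j, u j / ‖x j‖ / ‖y i - y j‖ := by
        simp [potential, Fintype.sum_option, hz, hv]
      have hi := hn i
      have hterm : ∀ j, u j / ‖x j‖ / ‖y i - y j‖ = ‖x i‖ * (u j / ‖x i - x j‖) := fun j => by
        have := hn j
        rw [hdist]
        field_simp
      rw [this, sum_congr rfl fun j _ => hterm j, ← mul_sum, hnorm]
      change _ + _ * potential x u i = 0
      rw [eq_neg_of_add_eq_zero_left (hpot i)]
      field_simp
      ring
  · rintro (_ | i)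
    -- The force at the new point vanishes because all the other forces do.
    · have h := sum_smul_field z v
      simpa [Fintype.sum_option, hsome] using h
    · rw [hsome, smul_zero]

omit [InnerProductSpace ℝ E] in
theorem potential_sub_const (x : ι → E) (u : ι → ℝ) (c : E) :
    potential (fun i => x i - c) u = potential x u := by
  funext i; simp [potential]

theorem field_sub_const (x : ι → E) (u : ι → ℝ) (c : E) :
    field (fun i => x i - c) u = field x u := by
  funext i; simp [field]

omit [InnerProductSpace ℝ E] in
theorem potential_comp_equiv (x : ι → E) (u : ι → ℝ) (e : κ ≃ ι) (i : κ) :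
    potential (x ∘ e) (u ∘ e) i = potential x u (e i) :=
  e.sum_comp fun j => u j / ‖x (e i) - x j‖

theorem field_comp_equiv (x : ι → E) (u : ι → ℝ) (e : κ ≃ ι) (i : κ) :
    field (x ∘ e) (u ∘ e) i = field x u (e i) :=
  e.sum_comp fun j => (u j / ‖x (e i) - x j‖ ^ 3) • (x (e i) - x j)

end System

/-! ### Limits of degenerating configurations -/

section Limits

variable {ι α E : Type*} [Fintype ι] [NormedAddCommGroup E] [InnerProductSpace ℝ E] [ProperSpace E]

theorem _root_.Ultrafilter.exists_tendsto_of_norm_le {F : Type*} [SeminormedAddCommGroup F]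
    [ProperSpace F] (l : Ultrafilter α) {f : α → F} {M : ℝ} (h : ∀ᶠ n in l, ‖f n‖ ≤ M) :
    ∃ a, Tendsto f l (𝓝 a) := by
  obtain ⟨a, -, ha⟩ := (isCompact_closedBall (0 : F) M).ultrafilter_le_nhds (l.map f)
    (le_principal_iff.2 (h.mono fun n hn => by simpa using hn))
  exact ⟨a, ha⟩

omit [Fintype ι] in
/-- A finite range is constant along an ultrafilter. -/
theorem _root_.Ultrafilter.exists_eventually_eq [Finite ι] (l : Ultrafilter α) (f : α → ι) :
    ∃ i, ∀ᶠ n in l, f n = i := by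
  by_contra! h
  obtain ⟨n, hn⟩ := (eventually_all.2 h).exists
  exact hn (f n) rfl

/-- Blow-up at a cluster of unit scale. The charges indexed by `J` are the ones that count in the
limit; they have size at least `1`, hence so have their distances. Of these, the charges `S` at
bounded distance from the origin converge to an equilibrium, and those going to infinity contribute
a constant potential `b`. The bounded point `x k` prevents `S` from being a single charge. -/
theorem exists_limit_equilibrium (l : Ultrafilter α) {x : α → ι → E} {u : α → ι → ℝ}
    (hle : ∀ n i j, i ≠ j → |u n j| ≤ ‖x n i - x n j‖)
    (hpot : ∀ i, Tendsto (fun n => potential (x n) (u n) i) l (𝓝 0))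
    (hfield : ∀ i, Tendsto (fun n => u n i • field (x n) (u n) i) l (𝓝 0))
    {J : Finset ι} (hJ : ∀ j ∈ J, ∀ᶠ n in l, 1 ≤ |u n j|)
    (hJ' : ∀ j ∉ J, ∀ i, Tendsto (fun n => u n j / ‖x n i - x n j‖) l (𝓝 0))
    {j₀ k : ι} (hj₀ : j₀ ∈ J) (hu₀ : ∀ᶠ n in l, |u n j₀| = 1) (hx₀ : ∀ n, x n j₀ = 0)
    (hk : k ≠ j₀) {M : ℝ} (hkM : ∀ᶠ n in l, ‖x n k‖ ≤ M) :
    ∃ (S : Finset ι) (y : ι → E) (v : ι → ℝ) (b : ℝ), 2 ≤ #S ∧ (b ≠ 0 → #S < Fintype.card ι) ∧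
      (∀ i ∈ S, v i ≠ 0) ∧ Set.InjOn y S ∧ (∀ i ∈ S, ∑ j ∈ S, v j / ‖y i - y j‖ + b = 0) ∧
      ∀ i ∈ S, ∑ j ∈ S, (v j / ‖y i - y j‖ ^ 3) • (y i - y j) = 0 := by
  classical
  set S : Finset ι := {j ∈ J | ∃ M : ℝ, ∀ᶠ n in l, ‖x n j‖ ≤ M}
  have hSJ : ∀ {j}, j ∈ S → j ∈ J := fun h => (mem_filter.1 h).1
  have hSb : ∀ {j}, j ∈ S → ∃ M : ℝ, ∀ᶠ n in l, ‖x n j‖ ≤ M := fun h => (mem_filter.1 h).2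
  have hj₀S : j₀ ∈ S := mem_filter.2 ⟨hj₀, 0, Eventually.of_forall fun n => by simp [hx₀]⟩
  have hy : ∀ j, ∃ y : E, j ∈ S → Tendsto (fun n => x n j) l (𝓝 y) := fun j => by
    by_cases h : j ∈ S
    · obtain ⟨M, hM⟩ := hSb h
      obtain ⟨y, hy⟩ := l.exists_tendsto_of_norm_le hM
      exact ⟨y, fun _ => hy⟩
    · exact ⟨0, fun h' => absurd h' h⟩
  choose y hy using hy
  have hv : ∀ j, ∃ v : ℝ, j ∈ S → Tendsto (fun n => u n j) l (𝓝 v) := fun j => by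
    by_cases h : j ∈ S
    · have : ∃ M : ℝ, ∀ᶠ n in l, ‖u n j‖ ≤ M := by
        rcases eq_or_ne j j₀ with rfl | hj
        · exact ⟨1, hu₀.mono fun n hn => hn.le⟩
        · obtain ⟨M, hM⟩ := hSb h
          refine ⟨M, hM.mono fun n hn => (hle n j₀ j hj.symm).trans ?_⟩
          rwa [hx₀, zero_sub, norm_neg]
      obtain ⟨M, hM⟩ := this
      obtain ⟨v, hv⟩ := l.exists_tendsto_of_norm_le hM
      exact ⟨v, fun _ => hv⟩
    · exact ⟨0, fun h' => absurd h' h⟩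
  choose v hv using hv
  have hv1 : ∀ j ∈ S, 1 ≤ |v j| := fun j hj => ge_of_tendsto (hv j hj).abs (hJ j (hSJ hj))
  have hy1 : ∀ i ∈ S, ∀ j ∈ S, i ≠ j → 1 ≤ ‖y i - y j‖ := fun i hi j hj hij =>
    ge_of_tendsto ((hy i hi).sub (hy j hj)).norm
      ((hJ j (hSJ hj)).mono fun n hn => hn.trans (hle n i j hij))
  have hfar : ∀ j ∈ J, j ∉ S → ∀ i, (∃ M : ℝ, ∀ᶠ n in l, ‖x n i‖ ≤ M) →
      Tendsto (fun n => ‖x n i - x n j‖) l atTop := fun j hj hjS i ⟨M, hM⟩ => by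
    refine tendsto_atTop.2 fun K => ?_
    have : ∀ᶠ n in l, ¬ ‖x n j‖ ≤ M + K :=
      Ultrafilter.eventually_not.2 fun h => hjS (mem_filter.2 ⟨hj, M + K, h⟩)
    filter_upwards [hM, this] with n h1 h2
    have := norm_sub_norm_le (x n j) (x n i)
    rw [norm_sub_rev] at this
    linarith
  -- The contribution of a charge outside `S` to the potential has the same limit at all bounded
  -- points.
  have hc : ∀ j, ∃ c : ℝ, j ∉ S → ∀ i, (∃ M : ℝ, ∀ᶠ n in l, ‖x n i‖ ≤ M) →
      Tendsto (fun n => u n j / ‖x n i - x n j‖) l (𝓝 c) := fun j => by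
    by_cases hj : j ∈ J
    · have hb : ∀ᶠ n in l, ‖u n j / ‖x n j₀ - x n j‖‖ ≤ 1 := Eventually.of_forall fun n => by
        rcases eq_or_ne j₀ j with rfl | h
        · simp
        · rw [norm_div, norm_norm]
          exact div_le_one_of_le₀ (hle n j₀ j h) (norm_nonneg _)
      obtain ⟨c, hc⟩ := l.exists_tendsto_of_norm_le hb
      refine ⟨c, fun hjS i hi => ?_⟩
      have hd := hfar j hj hjS i hi
      have hd₀ := hfar j hj hjS j₀ (hSb hj₀S)
      have hne : j₀ ≠ j := fun h => hjS (h ▸ hj₀S)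
      obtain ⟨M, hM⟩ := hi
      have hsub : Tendsto (fun n => u n j / ‖x n i - x n j‖ - u n j / ‖x n j₀ - x n j‖) l
          (𝓝 0) := by
        refine squeeze_zero_norm' ?_ (tendsto_const_nhds (x := M) |>.div_atTop hd)
        filter_upwards [hd.eventually_gt_atTop 0, hd₀.eventually_gt_atTop 0, hM] with n h1 h2 h3
        have e : u n j / ‖x n i - x n j‖ - u n j / ‖x n j₀ - x n j‖
            = u n j / ‖x n j₀ - x n j‖
              * ((‖x n j₀ - x n j‖ - ‖x n i - x n j‖) / ‖x n i - x n j‖) := by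
          field_simp
        have h4 : |‖x n j₀ - x n j‖ - ‖x n i - x n j‖| ≤ M := by
          refine (abs_norm_sub_norm_le _ _).trans ?_
          rwa [sub_sub_sub_cancel_right, hx₀, zero_sub, norm_neg]
        rw [e, norm_mul, norm_div, norm_div, norm_norm, norm_norm]
        refine (mul_le_of_le_one_left (by positivity)
          (div_le_one_of_le₀ (hle n j₀ j hne) h2.le)).trans ?_
        exact div_le_div_of_nonneg_right h4 h1.le
      simpa using hsub.add hc
    · exact ⟨0, fun _ i _ => hJ' j hj i⟩
  choose c hc using hc
  set b : ℝ := ∑ j ∈ Sᶜ, c j with hb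
  have hlim : ∀ i, (∃ M : ℝ, ∀ᶠ n in l, ‖x n i‖ ≤ M) →
      Tendsto (fun n => ∑ j ∈ S, u n j / ‖x n i - x n j‖) l (𝓝 (-b)) := fun i hi => by
    have h := (hpot i).sub (tendsto_finsetSum Sᶜ fun j hj => hc j (mem_compl.1 hj) i hi)
    rw [zero_sub] at h
    refine h.congr fun n => ?_
    rw [potential, ← sum_add_sum_compl S, add_sub_cancel_right]
  have hterm : ∀ i ∈ S, ∀ j ∈ S, Tendsto (fun n => u n j / ‖x n i - x n j‖) l
      (𝓝 (v j / ‖y i - y j‖)) := fun i hi j hj => by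
    rcases eq_or_ne i j with rfl | hij
    · simp
    · exact (hv j hj).div ((hy i hi).sub (hy j hj)).norm
        (zero_lt_one.trans_le (hy1 i hi j hj hij)).ne'
  have hpotS : ∀ i ∈ S, ∑ j ∈ S, v j / ‖y i - y j‖ = -b := fun i hi =>
    tendsto_nhds_unique (tendsto_finsetSum S (hterm i hi)) (hlim i (hSb hi))
  refine ⟨S, y, v, b, ?_, ?_, ?_, ?_, ?_, ?_⟩
  · by_contra hcard
    have hS1 : S = {j₀} := (eq_of_subset_of_card_le (singleton_subset_iff.2 hj₀S) (by
      rw [card_singleton]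
      omega)).symm
    -- The equation at `j₀` gives `b = 0`, so the equation at `k` forces `u j₀ → 0`.
    have hb0 : b = 0 := by
      have := hpotS j₀ hj₀S
      simpa [hS1] using this
    have h1 := hlim k ⟨M, hkM⟩
    obtain ⟨a, ha⟩ := l.exists_tendsto_of_norm_le hkM
    simp only [hS1, sum_singleton, hb0, neg_zero, hx₀, sub_zero] at h1
    have h2 := (h1.mul ha.norm).abs
    have h3 : Tendsto (fun n => |u n j₀ / ‖x n k‖ * ‖x n k‖|) l (𝓝 1) := by
      refine tendsto_const_nhds.congr' ?_
      filter_upwards [hu₀] with n hn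
      have : |u n j₀| ≤ ‖x n k‖ := by simpa [hx₀] using hle n k j₀ hk
      rw [div_mul_cancel₀ _ (by linarith), hn]
    have := tendsto_nhds_unique h2 h3
    simp at this
  · intro hb0
    rw [← card_univ]
    refine card_lt_card (ssubset_univ_iff.2 fun h => hb0 ?_)
    rw [hb, h, compl_univ, sum_empty]
  · intro i hi h
    have := hv1 i hi
    rw [h, abs_zero] at this
    linarith
  · intro i hi j hj h
    by_contra hij
    have := hy1 i hi j hj hij
    rw [h, sub_self, norm_zero] at this
    linarith
  · intro i hi
    rw [hpotS i hi, neg_add_cancel]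
  · intro i hi
    have hout : ∀ j, j ∉ S →
        Tendsto (fun n => u n i • (u n j / ‖x n i - x n j‖ ^ 3) • (x n i - x n j)) l (𝓝 0) := by
      intro j hjS
      have hij : i ≠ j := fun h => hjS (h ▸ hi)
      have hnorm : ∀ n, ‖u n i • (u n j / ‖x n i - x n j‖ ^ 3) • (x n i - x n j)‖
          = |u n i| / ‖x n i - x n j‖ * (|u n j| / ‖x n i - x n j‖) := fun n => by
        rw [norm_smul, norm_div_norm_pow_three_smul, Real.norm_eq_abs]
        ring
      by_cases hj : j ∈ J
      · refine squeeze_zero_norm (fun n => ?_)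
          ((hv i hi).abs.div_atTop (hfar j hj hjS i (hSb hi)))
        rw [hnorm]
        exact mul_le_of_le_one_right (by positivity)
          (div_le_one_of_le₀ (hle n i j hij) (norm_nonneg _))
      · have h0 := (hJ' j hj i).abs
        rw [abs_zero] at h0
        refine squeeze_zero_norm (fun n => ?_) h0
        rw [hnorm, abs_div, abs_norm]
        refine mul_le_of_le_one_left (by positivity) (div_le_one_of_le₀ ?_ (norm_nonneg _))
        rw [norm_sub_rev]
        exact hle n j i hij.symm
    have h1 := (hfield i).sub (tendsto_finsetSum Sᶜ fun j hj => hout j (mem_compl.1 hj))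
    have h2 : Tendsto (fun n => ∑ j ∈ S, u n i • (u n j / ‖x n i - x n j‖ ^ 3) • (x n i - x n j)) l
        (𝓝 (∑ j ∈ S, v i • (v j / ‖y i - y j‖ ^ 3) • (y i - y j))) := by
      refine tendsto_finsetSum S fun j hj => ?_
      rcases eq_or_ne i j with rfl | hij
      · simp
      · exact (hv i hi).smul (((hv j hj).div (((hy i hi).sub (hy j hj)).norm.pow 3)
          (pow_pos (zero_lt_one.trans_le (hy1 i hi j hj hij)) 3).ne').smul
            ((hy i hi).sub (hy j hj)))
    have h3 := tendsto_nhds_unique h2 (h1.congr fun n => by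
      rw [field, smul_sum, ← sum_add_sum_compl S, add_sub_cancel_right])
    rw [sum_const_zero, sub_zero, ← smul_sum] at h3
    refine (smul_eq_zero.1 h3).resolve_left fun h => ?_
    have := hv1 i hi
    rw [h, abs_zero] at this
    linarith

end Limits
/-! ### Scaling -/

section Rescaling

variable {ι α E : Type*} [Fintype ι] [NormedAddCommGroup E] [InnerProductSpace ℝ E]

omit [InnerProductSpace ℝ E] in
theorem potential_smul (x : ι → E) (u : ι → ℝ) (t : ℝ) (i : ι) :
    potential x (t • u) i = t * potential x u i := by
  simp only [potential, mul_sum, Pi.smul_apply, smul_eq_mul, mul_div_assoc]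

theorem smul_field_smul (x : ι → E) (u : ι → ℝ) (t : ℝ) (i : ι) :
    (t • u) i • field x (t • u) i = t ^ 2 • u i • field x u i := by
  simp only [field, smul_sum, Pi.smul_apply, smul_eq_mul, smul_smul]
  exact sum_congr rfl fun j _ => by ring_nf

omit [Fintype ι] in
theorem div_norm_smul_sub (x : ι → E) (u : ι → ℝ) {t : ℝ} (ht : 0 < t) (c : E) (i j : ι) :
    t * u j / ‖t • (x i - c) - t • (x j - c)‖ = u j / ‖x i - x j‖ := by
  rw [← smul_sub, sub_sub_sub_cancel_right, norm_smul, Real.norm_of_nonneg ht.le,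
    mul_div_mul_left _ _ ht.ne']

theorem potential_smul_sub (x : ι → E) (u : ι → ℝ) {t : ℝ} (ht : 0 < t) (c : E) (i : ι) :
    potential (fun i => t • (x i - c)) (fun i => t * u i) i = potential x u i :=
  sum_congr rfl fun j _ => div_norm_smul_sub x u ht c i j

theorem smul_field_smul_sub (x : ι → E) (u : ι → ℝ) {t : ℝ} (ht : 0 < t) (c : E) (i : ι) :
    (t * u i) • field (fun i => t • (x i - c)) (fun i => t * u i) i = u i • field x u i := by
  simp only [field, smul_sum]
  refine sum_congr rfl fun j _ => ?_
  rw [← smul_sub, sub_sub_sub_cancel_right, norm_smul, Real.norm_of_nonneg ht.le]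
  simp only [smul_smul]
  congr 1
  rcases eq_or_ne ‖x i - x j‖ 0 with h | h
  · simp [h]
  · field_simp

/-- A sequence of configurations along which the normalised system is asymptotically solved has,
after rescaling at its smallest relevant charge, a limit in equilibrium. -/
theorem exists_equilibrium_of_tendsto_zero [ProperSpace E] (l : Ultrafilter α) {x : α → ι → E}
    {u : α → ι → ℝ} (hinj : ∀ n, Function.Injective (x n))
    (hone : ∀ n, ∑ i, ∑ j, (u n j / ‖x n i - x n j‖) ^ 2 = 1)
    (hpot : ∀ i, Tendsto (fun n => potential (x n) (u n) i) l (𝓝 0))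
    (hfield : ∀ i, Tendsto (fun n => u n i • field (x n) (u n) i) l (𝓝 0)) :
    ∃ (S : Finset ι) (y : ι → E) (v : ι → ℝ) (b : ℝ), 2 ≤ #S ∧ (b ≠ 0 → #S < Fintype.card ι) ∧
      (∀ i ∈ S, v i ≠ 0) ∧ Set.InjOn y S ∧ (∀ i ∈ S, ∑ j ∈ S, v j / ‖y i - y j‖ + b = 0) ∧
      ∀ i ∈ S, ∑ j ∈ S, (v j / ‖y i - y j‖ ^ 3) • (y i - y j) = 0 := by
  classical
  have hr1 : ∀ n i j, |u n j / ‖x n i - x n j‖| ≤ 1 := fun n i j => by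
    rw [← sq_le_one_iff_abs_le_one, ← hone n]
    refine (single_le_sum (f := fun j => (u n j / ‖x n i - x n j‖) ^ 2)
      (fun _ _ => sq_nonneg _) (mem_univ j)).trans ?_
    exact single_le_sum (f := fun i => ∑ j, (u n j / ‖x n i - x n j‖) ^ 2)
      (fun _ _ => sum_nonneg fun _ _ => sq_nonneg _) (mem_univ i)
  have hle : ∀ n i j, i ≠ j → |u n j| ≤ ‖x n i - x n j‖ := fun n i j hij => by
    have hpos : 0 < ‖x n i - x n j‖ := norm_pos_iff.2 (sub_ne_zero.2 ((hinj n).ne hij))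
    have := hr1 n i j
    rwa [abs_div, abs_norm, div_le_one hpos] at this
  have hr : ∀ i j, ∃ r : ℝ, Tendsto (fun n => u n j / ‖x n i - x n j‖) l (𝓝 r) := fun i j =>
    l.exists_tendsto_of_norm_le (Eventually.of_forall fun n => hr1 n i j)
  choose r hr using hr
  have hrone : ∑ i, ∑ j, r i j ^ 2 = 1 :=
    tendsto_nhds_unique
      (tendsto_finsetSum _ fun i _ => tendsto_finsetSum _ fun j _ => (hr i j).pow 2)
      (tendsto_const_nhds.congr fun n => (hone n).symm)
  set J : Finset ι := {j | ∃ i, r i j ≠ 0}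
  have hJne : J.Nonempty := by
    by_contra h
    have h0 : ∀ i j, r i j = 0 := fun i j => by
      by_contra hij
      exact h ⟨j, mem_filter.2 ⟨mem_univ j, i, hij⟩⟩
    simp [h0] at hrone
  -- The index of the smallest relevant charge is the same along the ultrafilter.
  choose f hfJ hfmin using fun n => exists_min_image J (fun j => |u n j|) hJne
  obtain ⟨j₀, hj₀⟩ := l.exists_eventually_eq f
  have hj₀J : j₀ ∈ J := by
    obtain ⟨n, hn⟩ := hj₀.exists
    exact hn ▸ hfJ n
  obtain ⟨-, k, hk⟩ := mem_filter.1 hj₀J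
  have hkj : k ≠ j₀ := by
    rintro rfl
    refine hk (tendsto_nhds_unique (hr k k) ?_)
    simp
  have hlow : ∀ᶠ n in l, |r k j₀| / 2 < |u n j₀ / ‖x n k - x n j₀‖| :=
    (hr k j₀).abs.eventually_const_lt (half_lt_self (abs_pos.2 hk))
  have hu : ∀ᶠ n in l, 0 < |u n j₀| := hlow.mono fun n hn => by
    refine abs_pos.2 fun h => ?_
    rw [h, zero_div, abs_zero] at hn
    exact absurd hn (half_pos (abs_pos.2 hk)).not_gt
  have ht : ∀ᶠ n in l, 0 < |u n j₀|⁻¹ := hu.mono fun n hn => inv_pos.2 hn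
  refine exists_limit_equilibrium l (x := fun n i => |u n j₀|⁻¹ • (x n i - x n j₀))
    (u := fun n i => |u n j₀|⁻¹ * u n i) (J := J) (j₀ := j₀) (k := k) (M := 2 / |r k j₀|)
    ?_ ?_ ?_ ?_ ?_ hj₀J ?_ ?_ hkj ?_
  · intro n i j hij
    rw [← smul_sub, sub_sub_sub_cancel_right, norm_smul, norm_inv, Real.norm_eq_abs, abs_abs,
      abs_mul, abs_inv, abs_abs]
    exact mul_le_mul_of_nonneg_left (hle n i j hij) (by positivity)
  · exact fun i => (hpot i).congr' (ht.mono fun n hn => (potential_smul_sub _ _ hn _ i).symm)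
  · exact fun i => (hfield i).congr' (ht.mono fun n hn => (smul_field_smul_sub _ _ hn _ i).symm)
  · intro j hj
    filter_upwards [hu, hj₀] with n h1 h2
    have h3 := hfmin n j hj
    rw [h2] at h3
    rw [abs_mul, abs_inv, abs_abs, inv_mul_eq_div, one_le_div h1]
    exact h3
  · intro j hj i
    have h0 : r i j = 0 := by
      by_contra h
      exact hj (mem_filter.2 ⟨mem_univ j, i, h⟩)
    rw [← h0]
    exact (hr i j).congr' (ht.mono fun n hn => (div_norm_smul_sub _ _ hn _ i j).symm)
  · filter_upwards [hu] with n hn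
    rw [abs_mul, abs_inv, abs_abs, inv_mul_cancel₀ hn.ne']
  · exact fun n => by simp
  · filter_upwards [hu, hlow] with n h1 h2
    have hpos : 0 < ‖x n k - x n j₀‖ := norm_pos_iff.2 (sub_ne_zero.2 ((hinj n).ne hkj))
    have hrp : 0 < |r k j₀| := abs_pos.2 hk
    rw [abs_div, abs_norm, lt_div_iff₀ hpos] at h2
    rw [norm_smul, norm_inv, Real.norm_eq_abs, abs_abs, inv_mul_eq_div, div_le_div_iff₀ h1 hrp]
    linarith

end Rescaling

/-! ### Reduction to systems with few points -/

section NoSolution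

variable {ι E : Type*} [Fintype ι] [NormedAddCommGroup E] [InnerProductSpace ℝ E]

omit [InnerProductSpace ℝ E] in
/-- The equations of zero potential are nondegenerate for two or three points. -/
theorem eq_zero_of_potential_eq_zero {q : ℕ} (hq : 2 ≤ q) (hq' : q ≤ 3) {x : Fin q → E}
    (hx : Function.Injective x) {u : Fin q → ℝ} (h : ∀ i, potential x u i = 0) : u = 0 := by
  have hd : ∀ i j, i ≠ j → ‖x i - x j‖ ≠ 0 := fun i j hij =>
    norm_ne_zero_iff.2 (sub_ne_zero.2 (hx.ne hij))
  interval_cases q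
  · have h0 := h 0
    have h1 := h 1
    simp only [potential, Fin.sum_univ_two, sub_self, norm_zero, div_zero, zero_add, add_zero,
      div_eq_zero_iff, hd 0 1 (by decide), hd 1 0 (by decide), or_false] at h0 h1
    ext i
    fin_cases i
    exacts [h1, h0]
  · have h0 := h 0
    have h1 := h 1
    have h2 := h 2
    have e01 := inv_ne_zero (hd 0 1 (by decide))
    have e02 := inv_ne_zero (hd 0 2 (by decide))
    have e12 := inv_ne_zero (hd 1 2 (by decide))
    simp only [potential, Fin.sum_univ_three, sub_self, norm_zero, norm_sub_rev (x 1) (x 0),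
      norm_sub_rev (x 2) (x 0), norm_sub_rev (x 2) (x 1), div_eq_mul_inv] at h0 h1 h2
    set a := ‖x 0 - x 1‖⁻¹
    set b := ‖x 0 - x 2‖⁻¹
    set c := ‖x 1 - x 2‖⁻¹
    have k0 : u 0 * (a * b) = 0 := by linear_combination (b * h1 + a * h2 - c * h0) / 2
    have k1 : u 1 * (a * c) = 0 := by linear_combination (c * h0 + a * h2 - b * h1) / 2
    have k2 : u 2 * (b * c) = 0 := by linear_combination (c * h0 + b * h1 - a * h2) / 2
    ext i
    fin_cases i
    exacts [(mul_eq_zero.1 k0).resolve_right (mul_ne_zero e01 e02),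
      (mul_eq_zero.1 k1).resolve_right (mul_ne_zero e01 e12),
      (mul_eq_zero.1 k2).resolve_right (mul_ne_zero e02 e12)]

variable [ProperSpace E]

/-- If no system of at least two and at most `card ι` points has a non-zero solution, then no
sequence of configurations of points indexed by `ι` solves it asymptotically. -/
theorem not_tendsto_zero_of_no_solution [Nontrivial E] {α : Type*}
    (H : ∀ q : ℕ, 2 ≤ q → q ≤ Fintype.card ι → ∀ x : Fin q → E, Function.Injective x →
      ∀ u : Fin q → ℝ, (∀ i, potential x u i = 0) → (∀ i, u i • field x u i = 0) → u = 0)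
    (l : Ultrafilter α) {x : α → ι → E} {u : α → ι → ℝ} (hinj : ∀ n, Function.Injective (x n))
    (hone : ∀ n, ∑ i, ∑ j, (u n j / ‖x n i - x n j‖) ^ 2 = 1)
    (hpot : ∀ i, Tendsto (fun n => potential (x n) (u n) i) l (𝓝 0))
    (hfield : ∀ i, Tendsto (fun n => u n i • field (x n) (u n) i) l (𝓝 0)) : False := by
  have H' : ∀ (κ : Type _) [Fintype κ], 2 ≤ Fintype.card κ → Fintype.card κ ≤ Fintype.card ι →
      ∀ x : κ → E, Function.Injective x → ∀ u : κ → ℝ, (∀ i, potential x u i = 0) →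
        (∀ i, u i • field x u i = 0) → u = 0 := fun κ _ h2 hι x hx u hp hf => by
    set e := (Fintype.equivFin κ).symm
    have h := H _ h2 hι (x ∘ e) (hx.comp e.injective) (u ∘ e)
      (fun i => by rw [potential_comp_equiv, hp])
      (fun i => by rw [field_comp_equiv, Function.comp_apply, hf])
    ext i
    simpa using congrFun h (e.symm i)
  obtain ⟨S, y, v, b, hS2, hSb, hv, hy, hp, hf⟩ :=
    exists_equilibrium_of_tendsto_zero l hinj hone hpot hfield
  have hyS : Function.Injective fun i : S => y i := fun i j h => Subtype.ext (hy i.2 j.2 h)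
  have hpS : ∀ i : S, potential (fun i : S => y i) (fun i : S => v i) i + b = 0 := fun i => by
    rw [← hp i i.2, potential, sum_coe_sort S fun j => v j / ‖y i - y j‖]
  have hfS : ∀ i : S, field (fun i : S => y i) (fun i : S => v i) i = 0 := fun i => by
    rw [← hf i i.2, field, sum_coe_sort S fun j => (v j / ‖y i - y j‖ ^ 3) • (y i - y j)]
  rcases eq_or_ne b 0 with rfl | hb
  · obtain ⟨i, hi⟩ : S.Nonempty := card_pos.1 (by omega)
    have h := H' S (by simpa using hS2) (by simpa using card_le_univ S) _ hyS _
      (fun i => by simpa using hpS i) (fun i => by rw [hfS, smul_zero])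
    exact hv i hi (congrFun h ⟨i, hi⟩)
  · -- Invert about a point `c` that carries no charge.
    have := Module.Free.infinite ℝ E
    obtain ⟨c, -, hc⟩ := (Set.infinite_univ (α := E)).exists_notMem_finite
      (Set.finite_range fun i : S => y i)
    obtain ⟨z, hz, w, hw, hpz, hfz⟩ := exists_solution_option_of_ne_zero
      (x := fun i : S => y i - c) (fun i j h => hyS (sub_left_injective h)) hb
      (fun i => by rw [potential_sub_const fun i : S => y i, hpS])
      (fun i => by rw [field_sub_const fun i : S => y i, hfS])
      (fun i h => hc ⟨i, sub_eq_zero.1 h⟩)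
    have hcard : Fintype.card (Option S) = #S + 1 := by simp
    have := hSb hb
    exact hw (H' (Option S) (by omega) (by omega) z hz w hpz hfz)

end NoSolution

/-! ### The gradient of the matrix entries -/

section Gradient

variable {E : Type*} [NormedAddCommGroup E] [InnerProductSpace ℝ E] [CompleteSpace E]

theorem hasGradientAt_one_div_norm_sub {x c : E} (h : x ≠ c) :
    HasGradientAt (fun y => 1 / ‖y - c‖) (-(1 / ‖x - c‖ ^ 3) • (x - c)) x := by
  have hn : ‖x - c‖ ≠ 0 := norm_ne_zero_iff.2 (sub_ne_zero.2 h)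
  have h1 : HasFDerivAt (fun y => ‖y - c‖ ^ 2) _ x := ((hasFDerivAt_id x).sub_const c).norm_sq
  have h2 := (h1.sqrt (pow_ne_zero 2 hn))
  simp only [Real.sqrt_sq (norm_nonneg _)] at h2
  have h3 := (hasDerivAt_inv hn).comp_hasFDerivAt x h2
  rw [hasGradientAt_iff_hasFDerivAt]
  refine (h3.congr_fderiv ?_).congr_of_eventuallyEq (Eventually.of_forall fun y => ?_)
  · ext w
    simp
    field_simp
  · simp

end Gradient

/-! ### The inequality -/

section Inequality

variable {p m : ℕ}

/-- For `i = j` both sides are `0`: the vectors on the right are then `x k - x k`. -/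
theorem dA_apply {x : Fin p → EuclideanSpace ℝ (Fin m)} (hx : Function.Injective x)
    (k i j : Fin p) :
    dA x k i j = (if i = k then -(1 / ‖x k - x j‖ ^ 3) • (x k - x j) else 0)
      + if j = k then -(1 / ‖x k - x i‖ ^ 3) • (x k - x i) else 0 := by
  simp only [dA, A, Matrix.of_apply]
  rcases eq_or_ne i j with rfl | hij
  · rcases eq_or_ne i k with rfl | h
    · simp
    · simp [h]
  simp only [hij, if_false]
  rcases eq_or_ne i k with rfl | hik
  · simp only [Function.update_self, Function.update_of_ne hij.symm, if_true, hij.symm, if_false,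
      add_zero]
    exact (hasGradientAt_one_div_norm_sub (hx.ne hij)).gradient
  · simp only [Function.update_of_ne hik, hik, if_false, zero_add]
    rcases eq_or_ne j k with rfl | hjk
    · simp only [Function.update_self, if_true, norm_sub_rev (x i)]
      exact (hasGradientAt_one_div_norm_sub (hx.ne hij.symm)).gradient
    · simp [hjk]

theorem quadForm_dA {x : Fin p → EuclideanSpace ℝ (Fin m)} (hx : Function.Injective x)
    (u : Fin p → ℝ) (k : Fin p) : quadForm (dA x k) u = (-2 : ℝ) • u k • field x u k := by
  have h : ∀ j, (u j * u k) • (-(1 / ‖x k - x j‖ ^ 3) • (x k - x j))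
      = -(u k • (u j / ‖x k - x j‖ ^ 3) • (x k - x j)) := fun j => by
    rw [smul_smul, smul_smul, ← neg_smul]
    congr 1
    ring
  simp only [quadForm, dA_apply hx, smul_add, sum_add_distrib, smul_ite, smul_zero, sum_ite_irrel,
    sum_const_zero, sum_ite_eq', mem_univ, if_true]
  simp only [mul_comm (u k), h, sum_neg_distrib, ← smul_sum]
  change -(u k • field x u k) + -(u k • field x u k) = _
  rw [neg_smul, two_smul, neg_add]

theorem mulVec_A (x : Fin p → EuclideanSpace ℝ (Fin m)) (u : Fin p → ℝ) :
    (A x).mulVec u = potential x u := by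
  funext i
  simp only [Matrix.mulVec, dotProduct, potential, A, Matrix.of_apply]
  refine sum_congr rfl fun j _ => ?_
  split_ifs with h
  · simp [h]
  · ring

theorem isSolution_iff (x : Fin p → EuclideanSpace ℝ (Fin m)) (u : Fin p → ℝ) :
    IsSolution x u ↔ (∀ i, potential x u i = 0) ∧ ∀ i, u i • field x u i = 0 := by
  have h1 : ∀ i, ∑ j with j ≠ i, u j / ‖x i - x j‖ = potential x u i := fun i =>
    sum_filter_of_ne fun j _ h hji => h (by simp [hji])
  have h2 : ∀ i, ∑ j with j ≠ i, (u j / ‖x i - x j‖ ^ 3) • (x i - x j) = field x u i := fun i =>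
    sum_filter_of_ne fun j _ h hji => h (by simp [hji])
  simp only [IsSolution, h1, h2]

theorem sum_sum_ne_eq (x : Fin p → EuclideanSpace ℝ (Fin m)) (u : Fin p → ℝ) :
    ∑ i, ∑ j with j ≠ i, u j ^ 2 / ‖x i - x j‖ ^ 2 = ∑ i, ∑ j, (u j / ‖x i - x j‖) ^ 2 := by
  simp only [div_pow]
  exact sum_congr rfl fun i _ => sum_filter_of_ne fun j _ h hji => h (by simp [hji])

theorem eq_zero_of_inequality (hp : 2 ≤ p) (h : Inequality p m)
    {x : Fin p → EuclideanSpace ℝ (Fin m)} (hx : Function.Injective x) {u : Fin p → ℝ}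
    (hu : IsSolution x u) : u = 0 := by
  obtain ⟨c, hc, h⟩ := h
  obtain ⟨h1, h2⟩ := (isSolution_iff x u).1 hu
  have h3 := h x hx u
  have h4 : potential x u = 0 := funext h1
  simp only [mulVec_A, h4, quadForm_dA hx, h2, sum_sum_ne_eq, smul_zero, norm_zero,
    WithLp.toLp_zero, zero_pow two_ne_zero, Real.iSup_const_zero, add_zero] at h3
  have h5 : ∑ i, ∑ j, (u j / ‖x i - x j‖) ^ 2 = 0 :=
    le_antisymm (nonpos_of_mul_nonpos_right h3 hc)
      (sum_nonneg fun _ _ => sum_nonneg fun _ _ => sq_nonneg _)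
  have : Nontrivial (Fin p) := Fin.nontrivial_iff_two_le.2 hp
  ext j
  obtain ⟨i, hi⟩ := exists_ne j
  rw [sum_eq_zero_iff_of_nonneg fun _ _ => sum_nonneg fun _ _ => sq_nonneg _] at h5
  have h6 := h5 i (mem_univ i)
  rw [sum_eq_zero_iff_of_nonneg fun _ _ => sq_nonneg _] at h6
  have h7 := h6 j (mem_univ j)
  exact (div_eq_zero_iff.1 (pow_eq_zero_iff two_ne_zero |>.1 h7)).resolve_right
    (norm_ne_zero_iff.2 (sub_ne_zero.2 (hx.ne hi)))

/-- Homogeneity turns a failure of the inequality with constant `min ε (ε ^ 2)` into a configuration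
normalised by the right-hand side. -/
theorem exists_of_not_inequality (h : ¬ Inequality p m) {ε : ℝ} (hε : 0 < ε) :
    ∃ (x : Fin p → EuclideanSpace ℝ (Fin m)) (u : Fin p → ℝ), Function.Injective x ∧
      ∑ i, ∑ j, (u j / ‖x i - x j‖) ^ 2 = 1 ∧ (∀ i, ‖potential x u i‖ ≤ ε) ∧
      ∀ i, ‖u i • field x u i‖ ≤ ε := by
  simp only [Inequality, not_exists, not_and, not_forall, not_le] at h
  obtain ⟨x, hx, u, hlt⟩ := h (min ε (ε ^ 2)) (by positivity)
  rw [sum_sum_ne_eq, mulVec_A] at hlt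
  set R := ∑ i, ∑ j, (u j / ‖x i - x j‖) ^ 2 with hR
  have hbdd : BddAbove (Set.range fun i => ‖quadForm (dA x i) u‖) := (Set.finite_range _).bddAbove
  have hsup : 0 ≤ ⨆ i, ‖quadForm (dA x i) u‖ := Real.iSup_nonneg fun _ => norm_nonneg _
  have hRpos : 0 < R := by
    have h0 : 0 < min ε (ε ^ 2) * R := lt_of_le_of_lt (by positivity) hlt
    exact (pos_iff_pos_of_mul_pos h0).1 (by positivity)
  have hs := Real.sq_sqrt hRpos.le
  have hsp : 0 < √R := Real.sqrt_pos.2 hRpos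
  refine ⟨x, (√R)⁻¹ • u, hx, ?_, fun i => ?_, fun i => ?_⟩
  · simp only [Pi.smul_apply, smul_eq_mul, mul_div_assoc, mul_pow, ← mul_sum]
    rw [inv_pow, hs, ← hR, inv_mul_cancel₀ hRpos.ne']
  · rw [potential_smul, norm_mul, norm_inv, Real.norm_of_nonneg hsp.le, inv_mul_eq_div,
      div_le_iff₀ hsp]
    refine le_of_sq_le_sq ?_ (by positivity)
    have h1 : ‖potential x u i‖ ^ 2 ≤ ‖WithLp.toLp 2 (potential x u)‖ ^ 2 :=
      pow_le_pow_left₀ (norm_nonneg _) (PiLp.norm_apply_le (WithLp.toLp 2 (potential x u)) i) 2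
    rw [mul_pow, hs]
    have h2 : min ε (ε ^ 2) * R ≤ ε ^ 2 * R :=
      mul_le_mul_of_nonneg_right (min_le_right _ _) hRpos.le
    linarith
  · rw [smul_field_smul, norm_smul, norm_pow, norm_inv, Real.norm_of_nonneg hsp.le, inv_pow, hs,
      inv_mul_eq_div, div_le_iff₀ hRpos]
    have h1 := le_ciSup hbdd i
    simp only [quadForm_dA hx] at h1 hlt hsup
    rw [norm_smul, norm_neg, Real.norm_two] at h1
    have h2 : min ε (ε ^ 2) * R ≤ ε * R :=
      mul_le_mul_of_nonneg_right (min_le_left _ _) hRpos.le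
    have h3 := sq_nonneg ‖WithLp.toLp 2 (potential x u)‖
    have h4 := norm_nonneg (u i • field x u i)
    linarith

theorem inequality_of_no_solution (hp : 2 ≤ p)
    (H : ∀ q : ℕ, 4 ≤ q → q ≤ p → ∀ x : Fin q → EuclideanSpace ℝ (Fin m), Function.Injective x →
      ¬ ∃ u : Fin q → ℝ, u ≠ 0 ∧ IsSolution x u) : Inequality p m := by
  by_contra hneg
  choose x u hx hone hpot hfield using fun n : ℕ =>
    exists_of_not_inequality hneg (Nat.one_div_pos_of_nat (α := ℝ) (n := n))
  have : Nontrivial (Fin p) := Fin.nontrivial_iff_two_le.2 hp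
  have : Nontrivial (EuclideanSpace ℝ (Fin m)) := (hx 0).nontrivial
  have hε : Tendsto (fun n : ℕ => 1 / ((n : ℝ) + 1)) (hyperfilter ℕ) (𝓝 0) :=
    tendsto_one_div_add_atTop_nhds_zero_nat.mono_left Nat.hyperfilter_le_atTop
  refine not_tendsto_zero_of_no_solution (fun q h2 hq y hy v hv hv' => ?_) (hyperfilter ℕ) hx hone
    (fun i => squeeze_zero_norm (fun n => hpot n i) hε)
    (fun i => squeeze_zero_norm (fun n => hfield n i) hε)
  rw [Fintype.card_fin] at hq
  rcases le_or_gt 4 q with h4 | h4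
  · by_contra hne
    exact H q h4 hq y hy ⟨v, hne, (isSolution_iff y v).2 ⟨hv, hv'⟩⟩
  · exact eq_zero_of_potential_eq_zero h2 (by omega) hy hv

end Inequality

end BahriXu

theorem mainTheorem1 (m p₀ : ℕ) (hp₀ : 4 ≤ p₀) :
    (∀ p : ℕ, 4 ≤ p → p ≤ p₀ → BahriXu.Inequality p m) ↔
      ∀ p : ℕ, 4 ≤ p → p ≤ p₀ →
        ∀ x : Fin p → EuclideanSpace ℝ (Fin m), Function.Injective x →
          ¬ ∃ u : Fin p → ℝ, u ≠ 0 ∧ BahriXu.IsSolution x u := by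
  constructor
  · rintro h p hp hpp x hx ⟨u, hu, hsol⟩
    exact hu (BahriXu.eq_zero_of_inequality (by omega) (h p hp hpp) hx hsol)
  · exact fun h p hp hpp => BahriXu.inequality_of_no_solution (by omega) fun q hq hqp =>
      h q hq (hqp.trans hpp)
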